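/- In the (deterministic) synchronized bit model two players, Alice and Bob, hold inputs $x$ and $y$ and share a clock. A protocol runs for a fixed number $t$ of time steps; in each step each player sends $0$, $1$ or a blank, depending only on the player's own input and on everything sent in the earlier steps. The output is a function of the complete transcript. The communication complexity of the protocol is the maximum over all inputs of the number of bits sent by the two players together; blanks are not counted. For $n\ge 1$ let $\mathrm{Median}_n$ be the problem in which Alice holds a set $A\subseteq\{1,\dots,n\}$ and Bob holds a set $B\subseteq\{1,\dots,n\}$, not both empty, and the output is the median of the multiset union of $A$ and $B$, i.e. its $\lceil t/2\rceil$-th smallest element, where $t=|A|+|B|$ and common elements are counted twice. \textbf{Theorem.} The Median function does not admit a polynomial-time synchronized bit protocol with communication complexity $O(\log^{1-\varepsilon} n)$ for any $\varepsilon>0$. That is, for every real $\varepsilon>0$ there is no family $(P_n)_{n}$ of synchronized bit protocols such that $P_n$ computes $\mathrm{Median}_n$ for every $n$, the number of time steps of $P_n$ is $O(n^c)$ for some constant $c$, and the communication complexity of $P_n$ is $O(\log^{1-\varepsilon} n)$ as $n\to\infty$. -/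

import Mathlib

open Filter Asymptotics

/-- What is sent in one time step: Alice's symbol and Bob's symbol. Each of them is a bit
`some 0`, `some 1`, or the blank `none`. -/
abbrev SyncStep : Type := Option Bool × Option Bool

/-- A deterministic two-party protocol in the synchronized bit model. The parties share a clock,
and the protocol runs for `time` steps. In every step each party sends a bit or a blank, depending
on its own input and on everything sent in the earlier steps (earlier blanks included). After the
last step the output is read off the transcript. -/
structure SyncBitProtocol (X Y Z : Type) where
  /-- the number of time steps -/
  time : ℕ
  /-- what Alice sends next, given her input and the transcript so far -/
  alice : X → List SyncStep → Option Bool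
  /-- what Bob sends next, given his input and the transcript so far -/
  bob : Y → List SyncStep → Option Bool
  /-- the output, given the complete transcript -/
  output : List SyncStep → Z

namespace SyncBitProtocol

variable {X Y Z : Type}

/-- The transcript of the first `s` time steps on the input `(x, y)`, in chronological order. -/
def transcript (P : SyncBitProtocol X Y Z) (x : X) (y : Y) : ℕ → List SyncStep
  | 0 => []
  | s + 1 => P.transcript x y s ++
      [(P.alice x (P.transcript x y s), P.bob y (P.transcript x y s))]

/-- The output of the protocol on the input `(x, y)`. -/
def result (P : SyncBitProtocol X Y Z) (x : X) (y : Y) : Z :=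
  P.output (P.transcript x y P.time)

/-- The number of bits in a transcript; blanks are free. -/
def bitCount (h : List SyncStep) : ℕ :=
  (h.map fun s => s.1.toList.length + s.2.toList.length).sum

/-- `P` computes `f` on the set `D` of admissible inputs. -/
def Computes (P : SyncBitProtocol X Y Z) (D : Finset (X × Y)) (f : X → Y → Z) : Prop :=
  ∀ p ∈ D, P.result p.1 p.2 = f p.1 p.2

/-- The communication complexity of `P` on the set `D` of admissible inputs: the largest number of
bits sent by the two parties together on an input from `D`. -/
def cost (P : SyncBitProtocol X Y Z) (D : Finset (X × Y)) : ℕ :=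
  D.sup fun p => bitCount (P.transcript p.1 p.2 P.time)

end SyncBitProtocol

/-- The admissible inputs of the Median problem of size `n`: two subsets of `{1, …, n}`, not both
empty. -/
def medianInputs (n : ℕ) : Finset (Finset ℕ × Finset ℕ) :=
  ((Finset.Icc 1 n).powerset ×ˢ (Finset.Icc 1 n).powerset).filter fun p => (p.1 ∪ p.2).Nonempty

/-- The median of the multiset union of `A` and `B` (an element of both sets is counted twice):
if the union has `t ≥ 1` elements, it is the `⌈t / 2⌉`-th smallest one, which has position
`(t - 1) / 2` in the sorted list when positions are counted from zero. -/
def median (A B : Finset ℕ) : ℕ :=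
  ((A.val + B.val).sort (· ≤ ·)).getD ((A.card + B.card - 1) / 2) 0

/-!
The lower bound is a round elimination argument in which a round is a time step with a bit in it.
Between two bits the transcript contains only blanks, so on a rectangle of inputs with a common
transcript both parties effectively name the time of their next bit, and only the earlier name is
revealed. Take the last moment up to which at least half of either party's inputs stays silent. The
party that breaks the silence just after it may be forced to speak first: fixing its message leaves
a fraction `1 / (2 T)` of its inputs, where `T` is the number of steps, while the other party keeps
a constant fraction (`SyncBitProtocol.next_bit`).

The densities are restored by a direct sum structure. If Alice holds `r` independent instances and
Bob holds one instance together with the index of the relevant one, then a set of `Fin r → X` of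
density `δ` projects onto most of `X` in all but `O(log (1 / δ))` coordinates
(`exists_coordinate`). Hence `r = O(log T)` instances suffice to absorb a loss of a factor `2 T`
for Alice, at the expense of a small loss for Bob, and vice versa with the roles exchanged. So
nesting one split for Alice and one for Bob forces one more bit (`Hard.split`), and `k` nestings
force `k` bits.

Both splits can be carried out inside Median (`EmbedsInMedian.splitAlice`): Alice places her sets in
consecutive blocks, Bob places his set in one block and pads it on both sides so that the median
falls into this block. A double split enlarges the universe by a factor `9 r ^ 2`, so `k` bits are
needed as soon as `(9 r ^ 2) ^ k ≤ n` (`le_cost_of_computes_median`). For polynomial `T` this is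
a lower bound of order `log n / log log n`, which exceeds every `O(log ^ (1 - ε) n)`.
-/

/-! ### Protocols and the next bit -/

/-- The pigeonhole principle: some fibre has at least average size. -/
theorem Finset.exists_card_le_card_mul_card_fiber {α β : Type*} [DecidableEq β] {s : Finset α}
    {t : Finset β} {f : α → β} (hf : ∀ a ∈ s, f a ∈ t) (ht : t.Nonempty) :
    ∃ b ∈ t, s.card ≤ t.card * (s.filter fun a => f a = b).card := by
  obtain ⟨b, hb, hmax⟩ :=
    Finset.exists_max_image t (fun b => (s.filter fun a => f a = b).card) ht
  refine ⟨b, hb, ?_⟩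
  rw [mul_comm]
  exact Finset.card_le_mul_card_image_of_maps_to hf _ hmax

namespace SyncBitProtocol

variable {X Y Z X' Y' : Type}

/-- The protocol in which the parties translate their inputs by `a` and `b` and then run `P`. -/
def comap (P : SyncBitProtocol X Y Z) (a : X' → X) (b : Y' → Y) : SyncBitProtocol X' Y' Z where
  time := P.time
  alice x := P.alice (a x)
  bob y := P.bob (b y)
  output := P.output

theorem transcript_comap (P : SyncBitProtocol X Y Z) (a : X' → X) (b : Y' → Y) (x : X') (y : Y')
    (s : ℕ) : (P.comap a b).transcript x y s = P.transcript (a x) (b y) s := by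
  induction s with
  | zero => rfl
  | succ s ih => simp only [transcript, ih]; rfl

theorem result_comap (P : SyncBitProtocol X Y Z) (a : X' → X) (b : Y' → Y) (x : X') (y : Y') :
    (P.comap a b).result x y = P.result (a x) (b y) := by
  simp only [result, transcript_comap]; rfl

/-- The same protocol with the roles of Alice and Bob exchanged. -/
def swap (P : SyncBitProtocol X Y Z) : SyncBitProtocol Y X Z where
  time := P.time
  alice y h := P.bob y (h.map Prod.swap)
  bob x h := P.alice x (h.map Prod.swap)
  output h := P.output (h.map Prod.swap)

theorem transcript_swap (P : SyncBitProtocol X Y Z) (x : X) (y : Y) (s : ℕ) :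
    P.swap.transcript y x s = (P.transcript x y s).map Prod.swap := by
  induction s with
  | zero => rfl
  | succ s ih =>
    simp only [transcript, ih, List.map_append, List.map_cons, List.map_nil,
      List.append_cancel_left_eq]
    simp [swap]

theorem bitCount_append (h h' : List SyncStep) :
    bitCount (h ++ h') = bitCount h + bitCount h' := by
  simp [bitCount]

theorem bitCount_map_swap (h : List SyncStep) : bitCount (h.map Prod.swap) = bitCount h := by
  simp only [bitCount, List.map_map]
  congr 1
  exact List.map_congr_left fun s _ => Nat.add_comm _ _

theorem bitCount_transcript_mono (P : SyncBitProtocol X Y Z) (x : X) (y : Y) :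
    Monotone fun s => bitCount (P.transcript x y s) :=
  monotone_nat_of_le_succ fun s => by simp [transcript, bitCount_append]

/-- The history `h` followed by `u` steps in which nobody sends a bit. -/
def silentExtension (h : List SyncStep) (u : ℕ) : List SyncStep :=
  h ++ List.replicate u (none, none)

theorem bitCount_silentExtension (h : List SyncStep) (u : ℕ) :
    bitCount (silentExtension h u) = bitCount h := by
  simp [silentExtension, bitCount]

theorem silentExtension_succ (h : List SyncStep) (u : ℕ) :
    silentExtension h (u + 1) = silentExtension h u ++ [(none, none)] := by
  simp [silentExtension, List.replicate_succ']

theorem map_swap_silentExtension (h : List SyncStep) (u : ℕ) :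
    (silentExtension h u).map Prod.swap = silentExtension (h.map Prod.swap) u := by
  simp [silentExtension]

theorem map_swap_map_swap (h : List SyncStep) : (h.map Prod.swap).map Prod.swap = h := by
  simp

/-- On the input `x`, Alice stays silent for `u` steps after the history `h` as long as Bob does. -/
def AliceSilent (P : SyncBitProtocol X Y Z) (h : List SyncStep) (x : X) (u : ℕ) : Prop :=
  ∀ v < u, P.alice x (silentExtension h v) = none

/-- On the input `y`, Bob stays silent for `u` steps after the history `h` as long as Alice does. -/
def BobSilent (P : SyncBitProtocol X Y Z) (h : List SyncStep) (y : Y) (u : ℕ) : Prop :=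
  ∀ v < u, P.bob y (silentExtension h v) = none

theorem aliceSilent_swap (P : SyncBitProtocol X Y Z) (h : List SyncStep) (y : Y) (u : ℕ) :
    P.swap.AliceSilent (h.map Prod.swap) y u ↔ P.BobSilent h y u := by
  simp [AliceSilent, BobSilent, swap, map_swap_silentExtension]

theorem bobSilent_swap (P : SyncBitProtocol X Y Z) (h : List SyncStep) (x : X) (u : ℕ) :
    P.swap.BobSilent (h.map Prod.swap) x u ↔ P.AliceSilent h x u := by
  simp [AliceSilent, BobSilent, swap, map_swap_silentExtension]

theorem transcript_of_silent (P : SyncBitProtocol X Y Z) {h : List SyncStep} {x : X} {y : Y}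
    {s u : ℕ} (hs : P.transcript x y s = h) (hx : P.AliceSilent h x u) (hy : P.BobSilent h y u) :
    P.transcript x y (s + u) = silentExtension h u := by
  induction u with
  | zero => simp [silentExtension, hs]
  | succ u ih =>
    have := ih (fun v hv => hx v (hv.trans u.lt_succ_self))
      (fun v hv => hy v (hv.trans u.lt_succ_self))
    rw [← add_assoc, transcript, this, hx u u.lt_succ_self, hy u u.lt_succ_self,
      silentExtension_succ]

/-- On a rectangle where the transcript so far is `h`, suppose at least half of Alice's inputs
break the silence within `u + 1` steps, and at least half of Bob's inputs keep it for `u` steps.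
Keep a sixth of Bob's inputs, on which his symbol in step number `u + 1` is constant. Then any
set of talkative inputs of Alice has a part of relative size `1 / (2 * P.time)` on which the time
and the value of her next bit are fixed, and the transcript grows by at least one bit. -/
theorem exists_alice_speaks (P : SyncBitProtocol X Y Z) {S : Finset X} {R : Finset Y} {s u : ℕ}
    {h : List SyncStep} (hu : s + u < P.time)
    (hh : ∀ x ∈ S, ∀ y ∈ R, P.transcript x y s = h)
    [DecidablePred fun x => P.AliceSilent h x (u + 1)] [DecidablePred fun y => P.BobSilent h y u]
    (hS : 2 * (S.filter fun x => P.AliceSilent h x (u + 1)).card < S.card)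
    (hR : R.card ≤ 2 * (R.filter fun y => P.BobSilent h y u).card) :
    ∃ S' ⊆ S, ∃ R' ⊆ R, S.card ≤ 2 * S'.card ∧ R.card ≤ 6 * R'.card ∧
      ∀ S₁ ⊆ S', ∃ S₂ ⊆ S₁, S₁.card ≤ 2 * P.time * S₂.card ∧
        ∃ s' ≤ P.time, ∃ h', bitCount h + 1 ≤ bitCount h' ∧
          ∀ x ∈ S₂, ∀ y ∈ R', P.transcript x y s' = h' := by
  classical
  set Q := R.filter fun y => P.BobSilent h y u with hQ
  set S' := S.filter fun x => ¬ P.AliceSilent h x (u + 1) with hS'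
  obtain ⟨σ, -, hσ⟩ := Finset.exists_card_le_card_mul_card_fiber (s := Q)
    (t := (Finset.univ : Finset (Option Bool))) (f := fun y => P.bob y (silentExtension h u))
    (fun _ _ => Finset.mem_univ _) ⟨none, Finset.mem_univ _⟩
  have hfirst : ∀ x, ∃ w : ℕ × Bool, x ∈ S' → w.1 ≤ u ∧ P.AliceSilent h x w.1 ∧
      P.alice x (silentExtension h w.1) = some w.2 := fun x => by
    by_cases hx : x ∈ S'
    · have hex : ∃ v, v < u + 1 ∧ P.alice x (silentExtension h v) ≠ none := by
        have := (Finset.mem_filter.1 hx).2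
        simpa [AliceSilent] using this
      obtain ⟨hv, hne⟩ := Nat.find_spec hex
      obtain ⟨b, hb⟩ := Option.ne_none_iff_exists'.1 hne
      refine ⟨(Nat.find hex, b), fun _ => ⟨Nat.le_of_lt_succ hv, fun v hvlt => ?_, hb⟩⟩
      by_contra hcon
      exact Nat.find_min hex hvlt ⟨hvlt.trans hv, hcon⟩
    · exact ⟨(0, false), fun h => absurd h hx⟩
  choose w hw using hfirst
  refine ⟨S', Finset.filter_subset _ _, Q.filter fun y => P.bob y (silentExtension h u) = σ,
    (Finset.filter_subset _ _).trans (Finset.filter_subset _ _), ?_, ?_, fun S₁ hS₁ => ?_⟩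
  · have : (S.filter fun x => P.AliceSilent h x (u + 1)).card + S'.card = S.card := by
      convert Finset.card_filter_add_card_filter_not (s := S) fun x => P.AliceSilent h x (u + 1)
    omega
  · simp only [Finset.card_univ, Fintype.card_option, Fintype.card_bool] at hσ
    omega
  · obtain ⟨⟨v, b⟩, hvb, hfib⟩ := Finset.exists_card_le_card_mul_card_fiber (s := S₁)
      (t := Finset.range (u + 1) ×ˢ (Finset.univ : Finset Bool)) (f := w)
      (fun x hx => by
        simpa [Nat.lt_succ_iff] using (hw x (hS₁ hx)).1)
      ⟨(0, false), by simp⟩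
    have hvu : v ≤ u := by simpa [Nat.lt_succ_iff] using hvb
    refine ⟨S₁.filter fun x => w x = (v, b), Finset.filter_subset _ _, ?_, s + v + 1, by omega,
      silentExtension h v ++ [(some b, if v < u then none else σ)], ?_, fun x hx y hy => ?_⟩
    · refine hfib.trans (Nat.mul_le_mul_right _ ?_)
      simp only [Finset.card_product, Finset.card_range, Finset.card_univ, Fintype.card_bool]
      omega
    · rw [bitCount_append, bitCount_silentExtension]
      simp [bitCount]
    · obtain ⟨hx₁, hwx⟩ := Finset.mem_filter.1 hx
      obtain ⟨-, hsil, hbit⟩ := hw x (hS₁ hx₁)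
      simp only [hwx] at hsil hbit
      obtain ⟨hyQ, hyσ⟩ := Finset.mem_filter.1 hy
      obtain ⟨hyR, hysil⟩ := Finset.mem_filter.1 hyQ
      rw [transcript, transcript_of_silent P (hh x (Finset.filter_subset _ _ (hS₁ hx₁)) y hyR) hsil
        fun v' hv' => hysil v' (by omega), hbit]
      congr 3
      split_ifs with hlt
      · exact hysil v hlt
      · obtain rfl : v = u := by omega
        exact hyσ

/-- The mirror image of `exists_alice_speaks`, with Bob's next bit announced. -/
theorem exists_bob_speaks (P : SyncBitProtocol X Y Z) {S : Finset X} {R : Finset Y} {s u : ℕ}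
    {h : List SyncStep} (hu : s + u < P.time)
    (hh : ∀ x ∈ S, ∀ y ∈ R, P.transcript x y s = h)
    [DecidablePred fun x => P.AliceSilent h x u] [DecidablePred fun y => P.BobSilent h y (u + 1)]
    (hS : S.card ≤ 2 * (S.filter fun x => P.AliceSilent h x u).card)
    (hR : 2 * (R.filter fun y => P.BobSilent h y (u + 1)).card < R.card) :
    ∃ S' ⊆ S, ∃ R' ⊆ R, S.card ≤ 6 * S'.card ∧ R.card ≤ 2 * R'.card ∧
      ∀ R₁ ⊆ R', ∃ R₂ ⊆ R₁, R₁.card ≤ 2 * P.time * R₂.card ∧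
        ∃ s' ≤ P.time, ∃ h', bitCount h + 1 ≤ bitCount h' ∧
          ∀ x ∈ S', ∀ y ∈ R₂, P.transcript x y s' = h' := by
  classical
  obtain ⟨R', hR', S', hS', hRc, hSc, hfix⟩ :=
    P.swap.exists_alice_speaks (S := R) (R := S) (s := s) (u := u) (h := h.map Prod.swap) hu
      (fun y hy x hx => by rw [transcript_swap, hh x hx y hy])
      (by simpa only [aliceSilent_swap] using hR) (by simpa only [bobSilent_swap] using hS)
  refine ⟨S', hS', R', hR', hSc, hRc, fun R₁ hR₁ => ?_⟩
  obtain ⟨R₂, hR₂, hc, s', hs', h', hbits, htr⟩ := hfix R₁ hR₁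
  refine ⟨R₂, hR₂, hc, s', hs', h'.map Prod.swap, ?_, fun x hx y hy => ?_⟩
  · rwa [bitCount_map_swap] at hbits ⊢
  · rw [← htr y hy x hx, transcript_swap, map_swap_map_swap]

/-- On a rectangle where the transcript so far is known, either the protocol ends without a further
bit on a subrectangle of halves, or one party can be made to speak first at constant cost to the
density of the other party. In the latter case the message is not fixed yet: any set of the
remaining inputs of the speaker may be chosen before the message is fixed. -/
theorem next_bit (P : SyncBitProtocol X Y Z) {S : Finset X} {R : Finset Y} {s : ℕ}
    {h : List SyncStep} (hs : s ≤ P.time) (hh : ∀ x ∈ S, ∀ y ∈ R, P.transcript x y s = h) :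
    (∃ S' ⊆ S, ∃ R' ⊆ R, S.card ≤ 2 * S'.card ∧ R.card ≤ 2 * R'.card ∧
      ∃ h', ∀ x ∈ S', ∀ y ∈ R', P.transcript x y P.time = h') ∨
    (∃ S' ⊆ S, ∃ R' ⊆ R, S.card ≤ 2 * S'.card ∧ R.card ≤ 6 * R'.card ∧
      ∀ S₁ ⊆ S', ∃ S₂ ⊆ S₁, S₁.card ≤ 2 * P.time * S₂.card ∧
        ∃ s' ≤ P.time, ∃ h', bitCount h + 1 ≤ bitCount h' ∧
          ∀ x ∈ S₂, ∀ y ∈ R', P.transcript x y s' = h') ∨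
    (∃ S' ⊆ S, ∃ R' ⊆ R, S.card ≤ 6 * S'.card ∧ R.card ≤ 2 * R'.card ∧
      ∀ R₁ ⊆ R', ∃ R₂ ⊆ R₁, R₁.card ≤ 2 * P.time * R₂.card ∧
        ∃ s' ≤ P.time, ∃ h', bitCount h + 1 ≤ bitCount h' ∧
          ∀ x ∈ S', ∀ y ∈ R₂, P.transcript x y s' = h') := by
  classical
  let quiet : ℕ → Prop := fun u =>
    S.card ≤ 2 * (S.filter fun x => P.AliceSilent h x u).card ∧
      R.card ≤ 2 * (R.filter fun y => P.BobSilent h y u).card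
  by_cases hq : quiet (P.time - s)
  · refine Or.inl ⟨_, Finset.filter_subset _ _, _, Finset.filter_subset _ _, hq.1, hq.2,
      silentExtension h (P.time - s), fun x hx y hy => ?_⟩
    obtain ⟨hxS, hx⟩ := Finset.mem_filter.1 hx
    obtain ⟨hyR, hy⟩ := Finset.mem_filter.1 hy
    rw [← P.transcript_of_silent (hh x hxS y hyR) hx hy, Nat.add_sub_cancel' hs]
  · have hq0 : quiet 0 := by
      constructor
      · rw [Finset.filter_true_of_mem fun x _ v hv => absurd hv v.not_lt_zero]; omega
      · rw [Finset.filter_true_of_mem fun x _ v hv => absurd hv v.not_lt_zero]; omega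
    -- the last moment up to which both parties are silent on at least half of their inputs
    obtain ⟨u, hu, hqu, hqu'⟩ : ∃ u, u < P.time - s ∧ quiet u ∧ ¬ quiet (u + 1) := by
      by_contra! hcon
      have : ∀ u ≤ P.time - s, quiet u := fun u => by
        induction u with
        | zero => exact fun _ => hq0
        | succ u ih => exact fun hu => hcon u hu (ih (by omega))
      exact hq (this _ le_rfl)
    by_cases hA : 2 * (S.filter fun x => P.AliceSilent h x (u + 1)).card < S.card
    · exact Or.inr (Or.inl (P.exists_alice_speaks (by omega) hh hA hqu.2))
    · refine Or.inr (Or.inr (P.exists_bob_speaks (u := u) (by omega) hh hqu.1 ?_))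
      by_contra hB
      exact hqu' ⟨not_lt.1 hA, not_lt.1 hB⟩

end SyncBitProtocol

/-! ### Projections of dense sets -/

/-- If `S` fills more than a fraction `(3/4)^d` of `X^r` with `24 d ≤ r`, then fewer than `d`
projections of `S` miss a quarter of `X`. So a set `R` of pairs `(i, y)` of density `ρ` has a slice
of density `ρ - 1/24` at a coordinate `i` where the projection of `S` fills three quarters of `X`.
The map `a` completes each point of that projection to a point of `S`. -/
theorem exists_coordinate {X Y : Type} [Fintype X] [Fintype Y] [Nonempty X] [Nonempty Y] {d r : ℕ}
    (hr : 24 * d ≤ r) (S : Finset (Fin r → X)) (R : Finset (Fin r × Y)) {ρ : ℝ} (hρ : 1 / 24 ≤ ρ)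
    (hS : (3 / 4 : ℝ) ^ d * (Fintype.card X : ℝ) ^ r < S.card)
    (hR : ρ * (r * Fintype.card Y) ≤ R.card) :
    ∃ (i : Fin r) (S' : Finset X) (R' : Finset Y) (a : X → Fin r → X),
      (∀ x ∈ S', a x ∈ S ∧ a x i = x) ∧ (∀ y ∈ R', (i, y) ∈ R) ∧
      3 / 4 * (Fintype.card X : ℝ) ≤ S'.card ∧ (ρ - 1 / 24) * Fintype.card Y ≤ R'.card := by
  classical
  have hX : (0 : ℝ) < Fintype.card X := by exact_mod_cast Fintype.card_pos
  have hY : (0 : ℝ) < Fintype.card Y := by exact_mod_cast Fintype.card_pos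
  set p : Fin r → Finset X := fun i => S.image (· i) with hp
  set q : Fin r → Finset Y := fun i => Finset.univ.filter fun y => (i, y) ∈ R with hq
  set bad : Finset (Fin r) :=
    Finset.univ.filter fun i => ((p i).card : ℝ) < 3 / 4 * Fintype.card X with hbad
  have hprod : (S.card : ℝ) ≤ ∏ i, ((p i).card : ℝ) := by
    have : S ⊆ Fintype.piFinset p := fun x hx =>
      Fintype.mem_piFinset.2 fun i => Finset.mem_image_of_mem _ hx
    have := Finset.card_le_card this
    rw [Fintype.card_piFinset] at this
    exact_mod_cast this
  have hle : ∏ i, ((p i).card : ℝ) ≤ (3 / 4 : ℝ) ^ bad.card * (Fintype.card X : ℝ) ^ r := by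
    calc ∏ i, ((p i).card : ℝ)
        ≤ ∏ i, ((if i ∈ bad then 3 / 4 else 1) * (Fintype.card X : ℝ)) := by
          refine Finset.prod_le_prod (fun i _ => by positivity) fun i _ => ?_
          split_ifs with h
          · exact (Finset.mem_filter.1 h).2.le
          · rw [one_mul]; exact_mod_cast Finset.card_le_univ _
      _ = _ := by
          rw [Finset.prod_mul_distrib, Finset.prod_ite_mem, Finset.univ_inter, Finset.prod_const,
            Finset.prod_const, Finset.card_univ, Fintype.card_fin]
  have hcard : bad.card < d := by
    by_contra hcon
    have h1 : (3 / 4 : ℝ) ^ bad.card ≤ (3 / 4 : ℝ) ^ d :=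
      pow_le_pow_of_le_one (by norm_num) (by norm_num) (not_lt.1 hcon)
    have h2 := mul_le_mul_of_nonneg_right h1 (by positivity : 0 ≤ (Fintype.card X : ℝ) ^ r)
    linarith
  have hsum : (R.card : ℝ) = ∑ i, ((q i).card : ℝ) := by
    rw [Finset.card_eq_sum_card_fiberwise (f := Prod.fst) (t := Finset.univ)
      (fun _ _ => Finset.mem_coe.2 (Finset.mem_univ _))]
    push_cast
    refine Finset.sum_congr rfl fun i _ => ?_
    congr 1
    refine (Finset.card_bij (fun y _ => (i, y)) ?_ ?_ ?_).symm
    · intro y hy; simpa [hq] using hy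
    · intro y _ y' _ h; simpa using h
    · rintro ⟨j, y⟩ hb
      obtain ⟨hb, rfl⟩ := Finset.mem_filter.1 hb
      exact ⟨y, by simpa [hq] using hb, rfl⟩
  obtain ⟨i, hi, hqi⟩ : ∃ i, i ∉ bad ∧ (ρ - 1 / 24) * Fintype.card Y ≤ (q i).card := by
    by_contra! hcon
    have h1 : (R.card : ℝ) ≤
        ∑ i, ((if i ∈ bad then (Fintype.card Y : ℝ) else 0) + (ρ - 1 / 24) * Fintype.card Y) := by
      rw [hsum]
      refine Finset.sum_le_sum fun i _ => ?_
      split_ifs with h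
      · have h3 : ((q i).card : ℝ) ≤ Fintype.card Y := by exact_mod_cast Finset.card_le_univ _
        have : 0 ≤ (ρ - 1 / 24) * (Fintype.card Y : ℝ) := mul_nonneg (by linarith) hY.le
        linarith
      · linarith [hcon i h]
    rw [Finset.sum_add_distrib, Finset.sum_ite_mem] at h1
    simp only [Finset.univ_inter, Finset.sum_const, Finset.card_univ, Fintype.card_fin,
      nsmul_eq_mul] at h1
    have h2 : (bad.card : ℝ) * Fintype.card Y < d * Fintype.card Y :=
      mul_lt_mul_of_pos_right (by exact_mod_cast hcard) hY
    have h3 : (24 * d : ℝ) * Fintype.card Y ≤ r * Fintype.card Y :=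
      mul_le_mul_of_nonneg_right (by exact_mod_cast hr) hY.le
    nlinarith
  obtain ⟨x₀, -⟩ : S.Nonempty := by
    have : (0 : ℝ) < S.card := lt_of_le_of_lt (by positivity) hS
    exact Finset.card_pos.1 (by exact_mod_cast this)
  have hch : ∀ x : X, ∃ z : Fin r → X, x ∈ p i → z ∈ S ∧ z i = x := fun x => by
    by_cases hx : x ∈ p i
    · obtain ⟨z, hz, rfl⟩ := Finset.mem_image.1 hx
      exact ⟨z, fun _ => ⟨hz, rfl⟩⟩
    · exact ⟨x₀, fun h => absurd h hx⟩
  choose a ha using hch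
  refine ⟨i, p i, q i, a, ha, fun y hy => (Finset.mem_filter.1 hy).2, ?_, hqi⟩
  by_contra hcon
  exact hi (Finset.mem_filter.2 ⟨Finset.mem_univ _, not_le.1 hcon⟩)

/-! ### Round elimination -/

section RoundElimination

variable {X Y Z : Type}

/-- Alice holds `r` inputs of `f`, Bob holds one input and the index of the instance that matters;
the index is part of the output. -/
def splitAlice (r : ℕ) (f : X → Y → Z) (x : Fin r → X) (y : Fin r × Y) : Fin r × Z :=
  (y.1, f (x y.1) y.2)

/-- Bob holds `r` inputs of `f`, Alice holds one input and the index of the instance that matters;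
the index is part of the output. -/
def splitBob (r : ℕ) (f : X → Y → Z) : Fin r × X → (Fin r → Y) → Fin r × Z :=
  flip (splitAlice r (flip f))

namespace SyncBitProtocol

/-- The output of `P` determines `f` on the rectangle `S × R`, up to renaming the values. -/
def Determines (P : SyncBitProtocol X Y ℕ) (f : X → Y → Z) (S : Finset X) (R : Finset Y) : Prop :=
  ∀ x ∈ S, ∀ y ∈ R, ∀ x' ∈ S, ∀ y' ∈ R, P.result x y = P.result x' y' → f x y = f x' y'

end SyncBitProtocol

open SyncBitProtocol

/-- Even when the inputs are confined to half of the inputs on either side, and the transcript up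
to some step is known, every protocol for `f` with at most `T` steps sends at least `k` further
bits in the worst case. -/
def Hard [Fintype X] [Fintype Y] (f : X → Y → Z) (T k : ℕ) : Prop :=
  ∀ (P : SyncBitProtocol X Y ℕ) (S : Finset X) (R : Finset Y) (s : ℕ) (h : List SyncStep),
    P.time ≤ T → 1 / 2 * (Fintype.card X : ℝ) ≤ S.card → 1 / 2 * (Fintype.card Y : ℝ) ≤ R.card →
    s ≤ P.time → (∀ x ∈ S, ∀ y ∈ R, P.transcript x y s = h) → P.Determines f S R →
    ∃ x ∈ S, ∃ y ∈ R, bitCount h + k ≤ bitCount (P.transcript x y P.time)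

theorem hard_zero [Fintype X] [Fintype Y] [Nonempty X] [Nonempty Y] (f : X → Y → Z) (T : ℕ) :
    Hard f T 0 := by
  intro P S R s h _ hS hR hs hh _
  have hX : (0 : ℝ) < Fintype.card X := by exact_mod_cast Fintype.card_pos
  have hY : (0 : ℝ) < Fintype.card Y := by exact_mod_cast Fintype.card_pos
  obtain ⟨x, hx⟩ : S.Nonempty :=
    Finset.card_pos.1 (by exact_mod_cast (by linarith : (0 : ℝ) < S.card))
  obtain ⟨y, hy⟩ : R.Nonempty :=
    Finset.card_pos.1 (by exact_mod_cast (by linarith : (0 : ℝ) < R.card))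
  refine ⟨x, hx, y, hy, ?_⟩
  have := P.bitCount_transcript_mono x y hs
  simp only [hh x hx y hy] at this
  simpa using this

/-- A set of more than `|Y|` pairs `(i, y)` contains two with different indices, so no constant
output determines a split function on it. -/
theorem exists_splitAlice_ne [Fintype Y] {r : ℕ} (f : X → Y → Z) (x : Fin r → X)
    {R : Finset (Fin r × Y)} (hR : Fintype.card Y < R.card) :
    ∃ y ∈ R, ∃ y' ∈ R, splitAlice r f x y ≠ splitAlice r f x y' := by
  by_contra! hcon
  refine absurd hR (not_lt.2 ?_)
  refine Finset.card_le_card_of_injOn Prod.snd (fun _ _ => Finset.mem_coe.2 (Finset.mem_univ _)) ?_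
  intro y hy y' hy' heq
  exact Prod.ext (Prod.mk.inj (hcon y hy y' hy')).1 heq

/-- Bob's split after a message of his: although his inputs have only density `(3/4)^d`, his
projection to a suitable coordinate `j` has density `3/4`, and the inputs of Alice that point to `j`
still have density `3/4 - 1/24`. -/
theorem exists_bits_of_splitBob [Fintype X] [Fintype Y] [Nonempty X] [Nonempty Y] {f : X → Y → Z}
    {T k d r : ℕ} (hf : Hard f T k) (hr : 24 * d ≤ r)
    (P : SyncBitProtocol (Fin r × X) (Fin r → Y) ℕ) (hT : P.time ≤ T)
    {S : Finset (Fin r × X)} {R : Finset (Fin r → Y)} {s : ℕ} {h : List SyncStep}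
    (hS : 3 / 4 * (r * Fintype.card X : ℝ) ≤ S.card)
    (hR : (3 / 4 : ℝ) ^ d * (Fintype.card Y : ℝ) ^ r < R.card)
    (hs : s ≤ P.time) (hh : ∀ x ∈ S, ∀ y ∈ R, P.transcript x y s = h)
    (hdet : P.Determines (splitBob r f) S R) :
    ∃ x ∈ S, ∃ y ∈ R, bitCount h + k ≤ bitCount (P.transcript x y P.time) := by
  obtain ⟨j, R', S', b, hb, hS', hR'c, hS'c⟩ := exists_coordinate hr R S (by norm_num) hR hS
  have hX : (0 : ℝ) < Fintype.card X := by exact_mod_cast Fintype.card_pos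
  have hY : (0 : ℝ) < Fintype.card Y := by exact_mod_cast Fintype.card_pos
  obtain ⟨x, hx, y, hy, hxy⟩ := hf (P.comap (fun x => (j, x)) b) S' R' s h hT
    (by linarith) (by linarith) hs
    (fun x hx y hy => by rw [transcript_comap]; exact hh _ (hS' x hx) _ (hb y hy).1)
    (fun x hx y hy x' hx' y' hy' heq => by
      rw [result_comap, result_comap] at heq
      have := hdet _ (hS' x hx) _ (hb y hy).1 _ (hS' x' hx') _ (hb y' hy').1 heq
      simpa [splitBob, splitAlice, flip, (hb y hy).2, (hb y' hy').2] using this)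
  rw [transcript_comap] at hxy
  exact ⟨_, hS' x hx, _, (hb y hy).1, hxy⟩

/-- Two nested splits cost at least one more bit: the speaker's density drops by a factor `2 * T`
and the density of the other party by a constant, and the splits restore both densities. If Bob is
the speaker, Alice's split is resolved before his message is fixed, since afterwards the few
remaining inputs of Bob could all point to coordinates where Alice's inputs are sparse. -/
theorem Hard.split [Fintype X] [Fintype Y] [Nonempty X] [Nonempty Y] {f : X → Y → Z}
    {T k d r : ℕ} (hf : Hard f T k) (hd : 0 < d) (hr : 24 * d ≤ r)
    (hdT : 24 * (T + 1) * (3 / 4 : ℝ) ^ d < 1) :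
    Hard (splitAlice r (splitBob r f)) T (k + 1) := by
  intro P S R s h hT hS hR hs hh hdet
  have hr0 : (24 : ℝ) ≤ r := by exact_mod_cast (by omega : 24 ≤ r)
  have : NeZero r := ⟨by omega⟩
  have hX : (0 : ℝ) < Fintype.card X := by exact_mod_cast Fintype.card_pos
  have hY : (0 : ℝ) < Fintype.card Y := by exact_mod_cast Fintype.card_pos
  have hXr : (0 : ℝ) < Fintype.card (Fin r → Fin r × X) := by exact_mod_cast Fintype.card_pos
  have hYr : (0 : ℝ) < Fintype.card (Fin r → Y) := by exact_mod_cast Fintype.card_pos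
  have hcX : ((Fintype.card (Fin r → Fin r × X) : ℕ) : ℝ) = (Fintype.card (Fin r × X) : ℝ) ^ r := by
    simp
  have hcX1 : ((Fintype.card (Fin r × X) : ℕ) : ℝ) = r * Fintype.card X := by simp
  have hcY1 : ((Fintype.card (Fin r → Y) : ℕ) : ℝ) = (Fintype.card Y : ℝ) ^ r := by simp
  have hcY : ((Fintype.card (Fin r × (Fin r → Y)) : ℕ) : ℝ) = r * Fintype.card (Fin r → Y) := by
    simp
  rw [hcY] at hR
  have hpd : 0 < (3 / 4 : ℝ) ^ d := by positivity
  have hT0 : (0 : ℝ) ≤ T := Nat.cast_nonneg T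
  have hpT : (3 / 4 : ℝ) ^ d < 1 / 24 := by nlinarith
  -- a message fixed on a set of density `1 / 6` leaves a density of `1 / (12 * T)`, which is enough
  -- for a split
  have key : ∀ (D : ℝ) (c : ℕ), 0 < D → 1 / 6 * D ≤ 2 * P.time * c → (3 / 4 : ℝ) ^ d * D < c := by
    intro D c hD hc
    have h1 : (P.time : ℝ) ≤ T := by exact_mod_cast hT
    have h2 : (P.time : ℝ) * c ≤ T * c := mul_le_mul_of_nonneg_right h1 (Nat.cast_nonneg c)
    by_contra! hcon
    have h3 : (24 * T : ℝ) * c ≤ 24 * T * ((3 / 4) ^ d * D) :=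
      mul_le_mul_of_nonneg_left hcon (by positivity)
    have h4 := mul_lt_mul_of_pos_right hdT hD
    have h5 : 0 < (3 / 4 : ℝ) ^ d * D := mul_pos hpd hD
    nlinarith
  rcases P.next_bit hs hh with
    ⟨S', hS', R', hR', hSc, hRc, h', htr⟩ | ⟨S', hS', R', hR', hSc, hRc, hfix⟩ |
    ⟨S', hS', R', hR', hSc, hRc, hfix⟩
  · exfalso
    -- a constant output, although Bob's pairs, of density `1 / 4`, have several indices
    have hSc' : (S.card : ℝ) ≤ 2 * S'.card := by exact_mod_cast hSc
    have hRc' : (R.card : ℝ) ≤ 2 * R'.card := by exact_mod_cast hRc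
    obtain ⟨x, hx⟩ : S'.Nonempty :=
      Finset.card_pos.1 (by exact_mod_cast (by linarith : (0 : ℝ) < S'.card))
    obtain ⟨y, hy, y', hy', hne⟩ := exists_splitAlice_ne (splitBob r f) x (R := R') (by
      have : ((Fintype.card (Fin r → Y) : ℕ) : ℝ) < R'.card := by nlinarith
      exact_mod_cast this)
    exact hne (hdet x (hS' hx) y (hR' hy) x (hS' hx) y' (hR' hy')
      (by simp only [result, htr x hx y hy, htr x hx y' hy']))
  · have hSc' : (S.card : ℝ) ≤ 2 * S'.card := by exact_mod_cast hSc
    have hRc' : (R.card : ℝ) ≤ 6 * R'.card := by exact_mod_cast hRc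
    obtain ⟨S₂, hS₂, hS₂c, s', hs', h', hbits, htr⟩ := hfix S' subset_rfl
    have hS₂c' : (S'.card : ℝ) ≤ 2 * P.time * S₂.card := by exact_mod_cast hS₂c
    obtain ⟨i, S₃, R₃, a, ha, hR₃, hS₃c, hR₃c⟩ := exists_coordinate (ρ := 1 / 12) hr S₂ R'
      (by norm_num) (by rw [← hcX]; exact key _ _ hXr (by linarith)) (by linarith)
    obtain ⟨x, hx, y, hy, hxy⟩ := exists_bits_of_splitBob hf hr
      (P.comap a fun y => (i, y)) hT (S := S₃) (R := R₃) (s := s') (h := h')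
      (by rwa [← hcX1])
      (by
        rw [← hcY1]
        nlinarith)
      hs' (fun x hx y hy => by rw [transcript_comap]; exact htr _ (ha x hx).1 _ (hR₃ y hy))
      (fun x hx y hy x' hx' y' hy' heq => by
        rw [result_comap, result_comap] at heq
        have := hdet _ (hS' (hS₂ (ha x hx).1)) _ (hR' (hR₃ y hy)) _ (hS' (hS₂ (ha x' hx').1)) _
          (hR' (hR₃ y' hy')) heq
        simpa [splitAlice, (ha x hx).2, (ha x' hx').2] using this)
    rw [transcript_comap] at hxy
    refine ⟨_, hS' (hS₂ (ha x hx).1), _, hR' (hR₃ y hy), le_trans ?_ hxy⟩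
    omega
  · have hSc' : (S.card : ℝ) ≤ 6 * S'.card := by exact_mod_cast hSc
    have hRc' : (R.card : ℝ) ≤ 2 * R'.card := by exact_mod_cast hRc
    obtain ⟨i, S₃, R₃, a, ha, hR₃, hS₃c, hR₃c⟩ := exists_coordinate (ρ := 1 / 4) hr S' R'
      (by norm_num) (by rw [← hcX]; nlinarith) (by linarith)
    have hinj : Function.Injective (Prod.mk i : (Fin r → Y) → Fin r × (Fin r → Y)) :=
      Prod.mk_right_injective i
    obtain ⟨R₁, hR₁, hR₁c, s', hs', h', hbits, htr⟩ :=
      hfix (R₃.map ⟨_, hinj⟩) (fun z hz => by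
        obtain ⟨y, hy, rfl⟩ := Finset.mem_map.1 hz
        exact hR₃ y hy)
    obtain ⟨R₄, hR₄, rfl⟩ := Finset.subset_map_iff.1 hR₁
    rw [Finset.card_map, Finset.card_map] at hR₁c
    have hR₄c : (R₃.card : ℝ) ≤ 2 * P.time * R₄.card := by exact_mod_cast hR₁c
    obtain ⟨x, hx, y, hy, hxy⟩ := exists_bits_of_splitBob hf hr
      (P.comap a fun y => (i, y)) hT (S := S₃) (R := R₄) (s := s') (h := h')
      (by rwa [← hcX1]) (by rw [← hcY1]; exact key _ _ hYr (by linarith))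
      hs' (fun x hx y hy => by
        rw [transcript_comap]
        exact htr _ (ha x hx).1 _ (Finset.mem_map_of_mem ⟨_, hinj⟩ hy))
      (fun x hx y hy x' hx' y' hy' heq => by
        rw [result_comap, result_comap] at heq
        have := hdet _ (hS' (ha x hx).1) _ (hR' (hR₃ y (hR₄ hy))) _ (hS' (ha x' hx').1) _
          (hR' (hR₃ y' (hR₄ hy'))) heq
        simpa [splitAlice, (ha x hx).2, (ha x' hx').2] using this)
    rw [transcript_comap] at hxy
    refine ⟨_, hS' (ha x hx).1, _, hR' (hR₃ y (hR₄ hy)), le_trans ?_ hxy⟩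
    omega

end RoundElimination

/-! ### Medians of padded blocks -/

section MedianEncoding

variable {X Y Z : Type}

/-- The number of elements of `A` that are at most `v`. -/
def rank (A : Finset ℕ) (v : ℕ) : ℕ := (A.filter (· ≤ v)).card

/-- Fewer than half of the elements of the multiset union of `A` and `B` are below `v ≥ 1`, and more
than half of them are at most `v`. -/
def IsMiddle (A B : Finset ℕ) (v : ℕ) : Prop :=
  2 * (rank A (v - 1) + rank B (v - 1)) < A.card + B.card ∧
    A.card + B.card < 2 * (rank A v + rank B v)

theorem IsMiddle.symm {A B : Finset ℕ} {v : ℕ} (h : IsMiddle A B v) : IsMiddle B A v := by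
  unfold IsMiddle at *
  omega

theorem List.SortedLE.lt_countP {l : List ℕ} (hl : l.SortedLE) {k v : ℕ} (hk : k < l.length)
    (hv : l[k] ≤ v) : k < l.countP (· ≤ v) := by
  have h1 : (l.take (k + 1)).countP (· ≤ v) = (l.take (k + 1)).length := by
    rw [List.countP_eq_length]
    intro a ha
    obtain ⟨i, hi, rfl⟩ := List.mem_take_iff_getElem.1 ha
    have : l[i] ≤ l[k] := hl.getElem_le_getElem_of_le (by omega)
    simpa using this.trans hv
  have h2 := (List.take_sublist (k + 1) l).countP_le (p := (· ≤ v))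
  rw [h1, List.length_take] at h2
  omega

theorem List.SortedLE.countP_le {l : List ℕ} (hl : l.SortedLE) {k v : ℕ} (hk : k < l.length)
    (hv : v < l[k]) : l.countP (· ≤ v) ≤ k := by
  have h1 : (l.drop k).countP (· ≤ v) = 0 := by
    rw [List.countP_eq_zero]
    intro a ha
    obtain ⟨i, hi, rfl⟩ := List.mem_drop_iff_getElem.1 ha
    have : l[k] ≤ l[k + i] := hl.getElem_le_getElem_of_le (by omega)
    simpa using hv.trans_le this
  have h2 : (l.take k).countP (· ≤ v) ≤ k :=
    (List.countP_le_length).trans (by simp)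
  have h3 := List.countP_append (p := fun a : ℕ => decide (a ≤ v)) (l₁ := l.take k) (l₂ := l.drop k)
  rw [List.take_append_drop] at h3
  omega

theorem IsMiddle.median_eq {A B : Finset ℕ} {v : ℕ} (h : IsMiddle A B v) :
    median A B = v := by
  unfold median
  obtain ⟨h1, h2⟩ := h
  set l := (A.val + B.val).sort (· ≤ ·) with hl
  have hsort : l.SortedLE := (Multiset.pairwise_sort (A.val + B.val) (· ≤ ·)).sortedLE
  have hlen : l.length = A.card + B.card := by simp [hl]
  have hcount : ∀ w, l.countP (· ≤ w) = rank A w + rank B w := fun w => by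
    have : (l : Multiset ℕ) = A.val + B.val := Multiset.sort_eq _ _
    rw [← Multiset.coe_countP, this, Multiset.countP_add, Multiset.countP_eq_card_filter,
      Multiset.countP_eq_card_filter]
    rfl
  have hk : (A.card + B.card - 1) / 2 < l.length := by omega
  rw [List.getD_eq_getElem _ _ hk]
  apply le_antisymm
  · by_contra! hcon
    have := hsort.countP_le hk hcon
    rw [hcount] at this
    omega
  · by_contra! hcon
    have := hsort.lt_countP hk (Nat.le_sub_one_of_lt hcon)
    rw [hcount] at this
    omega

theorem rank_union {A B : Finset ℕ} (h : Disjoint A B) (v : ℕ) :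
    rank (A ∪ B) v = rank A v + rank B v := by
  rw [rank, Finset.filter_union,
    Finset.card_union_of_disjoint (Finset.disjoint_filter_filter h)]
  rfl

/-- The translate of a set of numbers by `c`. -/
def shift (c : ℕ) (A : Finset ℕ) : Finset ℕ := A.map (addLeftEmbedding c)

theorem card_shift (c : ℕ) (A : Finset ℕ) : (shift c A).card = A.card := Finset.card_map _

theorem mem_shift {c v : ℕ} {A : Finset ℕ} : v ∈ shift c A ↔ ∃ a ∈ A, c + a = v := by
  simp [shift]

theorem rank_shift_add (c : ℕ) (A : Finset ℕ) (v : ℕ) : rank (shift c A) (c + v) = rank A v := by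
  rw [rank, shift, Finset.filter_map, Finset.card_map, rank]
  congr 1
  ext a
  simp

theorem rank_eq_card {A : Finset ℕ} {v : ℕ} (h : ∀ a ∈ A, a ≤ v) : rank A v = A.card := by
  rw [rank, Finset.filter_true_of_mem h]

theorem rank_eq_zero {A : Finset ℕ} {v : ℕ} (h : ∀ a ∈ A, v < a) : rank A v = 0 := by
  rw [rank, Finset.card_eq_zero, Finset.filter_eq_empty_iff]
  exact fun a ha => not_le.2 (h a ha)

theorem mul_add_le_mul_of_lt {i j N a : ℕ} (hij : i < j) (ha : a ≤ N) : i * N + a ≤ j * N := by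
  have : (i + 1) * N ≤ j * N := Nat.mul_le_mul_right _ hij
  rw [add_mul, one_mul] at this
  omega

theorem block_unique {i j N a b : ℕ} (ha : a ∈ Finset.Icc 1 N) (hb : b ∈ Finset.Icc 1 N)
    (h : i * N + a = j * N + b) : i = j ∧ a = b := by
  rw [Finset.mem_Icc] at ha hb
  rcases lt_trichotomy i j with hij | rfl | hij
  · have := mul_add_le_mul_of_lt hij ha.2; omega
  · omega
  · have := mul_add_le_mul_of_lt hij hb.2; omega

/-- The sets `A l` side by side, in consecutive blocks of length `N` that start after `W`. -/
def blocks {r : ℕ} (W N : ℕ) (A : Fin r → Finset ℕ) : Finset ℕ :=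
  Finset.univ.biUnion fun l : Fin r => shift (W + l * N) (A l)

theorem disjoint_blocks {r W N : ℕ} {A : Fin r → Finset ℕ} (hA : ∀ l, A l ⊆ Finset.Icc 1 N)
    {l m : Fin r} (hlm : l ≠ m) :
    Disjoint (shift (W + l * N) (A l)) (shift (W + m * N) (A m)) := by
  rw [Finset.disjoint_left]
  intro v hv hv'
  obtain ⟨a, ha, rfl⟩ := mem_shift.1 hv
  obtain ⟨b, hb, hab⟩ := mem_shift.1 hv'
  exact hlm (Fin.ext (block_unique (hA l ha) (hA m hb) (by omega)).1)

theorem card_blocks {r W N p : ℕ} {A : Fin r → Finset ℕ} (hA : ∀ l, A l ⊆ Finset.Icc 1 N)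
    (hp : ∀ l, (A l).card = p) : (blocks W N A).card = r * p := by
  rw [blocks, Finset.card_biUnion fun l _ m _ hlm => disjoint_blocks hA hlm]
  simp [card_shift, hp]

theorem blocks_subset {r W N : ℕ} {A : Fin r → Finset ℕ} (hA : ∀ l, A l ⊆ Finset.Icc 1 N) :
    blocks W N A ⊆ Finset.Icc (W + 1) (W + r * N) := by
  intro v hv
  obtain ⟨l, -, hl⟩ := Finset.mem_biUnion.1 hv
  obtain ⟨a, ha, rfl⟩ := mem_shift.1 hl
  have ha' := Finset.mem_Icc.1 (hA l ha)
  have := mul_add_le_mul_of_lt l.2 ha'.2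
  rw [Finset.mem_Icc]
  omega

/-- The blocks before the `i`-th one count fully, those after it do not count. -/
theorem rank_blocks {r W N p : ℕ} {A : Fin r → Finset ℕ} (hA : ∀ l, A l ⊆ Finset.Icc 1 N)
    (hp : ∀ l, (A l).card = p) (i : Fin r) {u : ℕ} (hu : u ≤ N) :
    rank (blocks W N A) (W + i * N + u) = i * p + rank (A i) u := by
  have hsum : rank (blocks W N A) (W + i * N + u) =
      ∑ l : Fin r, rank (shift (W + l * N) (A l)) (W + i * N + u) := by
    rw [rank, blocks, Finset.filter_biUnion, Finset.card_biUnion fun l _ m _ hlm =>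
      Finset.disjoint_filter_filter (disjoint_blocks hA hlm)]
    rfl
  have hterm : ∀ l : Fin r, rank (shift (W + l * N) (A l)) (W + i * N + u) =
      (if l < i then p else 0) + if l = i then rank (A i) u else 0 := fun l => by
    rcases lt_trichotomy l i with hl | rfl | hl
    · rw [if_pos hl, if_neg hl.ne, rank_eq_card, card_shift, hp, add_zero]
      intro v hv
      obtain ⟨a, ha, rfl⟩ := mem_shift.1 hv
      have := mul_add_le_mul_of_lt hl (Finset.mem_Icc.1 (hA l ha)).2
      omega
    · rw [if_neg (lt_irrefl _), if_pos rfl, rank_shift_add, zero_add]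
    · rw [if_neg hl.not_gt, if_neg hl.ne', rank_eq_zero]
      intro v hv
      obtain ⟨a, ha, rfl⟩ := mem_shift.1 hv
      have := mul_add_le_mul_of_lt hl hu
      have := (Finset.mem_Icc.1 (hA l ha)).1
      omega
  rw [hsum, Finset.sum_congr rfl fun l _ => hterm l, Finset.sum_add_distrib,
    ← Finset.sum_filter, Finset.sum_const, Finset.sum_ite_eq' Finset.univ i,
    if_pos (Finset.mem_univ i)]
  have : (Finset.univ.filter fun l : Fin r => l < i).card = i := by
    rw [← Fin.card_Iio i]
    congr 1
    ext l
    simp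
  rw [this, smul_eq_mul]

/-- One set in the block that starts after `W + k`, padded by `m` small and by `m'` large numbers,
where the large ones lie above `W + M`. -/
def padded (W k M m m' : ℕ) (B : Finset ℕ) : Finset ℕ :=
  Finset.Icc 1 m ∪ shift (W + k) B ∪ Finset.Icc (W + M + 1) (W + M + m')

section padded

variable {W k M m m' N : ℕ} {B : Finset ℕ}

theorem disjoint_padded_left (hB : B ⊆ Finset.Icc 1 N) (hm : m ≤ W) :
    Disjoint (Finset.Icc 1 m) (shift (W + k) B) := by
  rw [Finset.disjoint_left]
  intro v hv hv'
  obtain ⟨a, ha, rfl⟩ := mem_shift.1 hv'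
  have := (Finset.mem_Icc.1 hv).2
  have := (Finset.mem_Icc.1 (hB ha)).1
  omega

theorem disjoint_padded_right (hB : B ⊆ Finset.Icc 1 N) (hm : m ≤ W) (hk : k + N ≤ M) :
    Disjoint (Finset.Icc 1 m ∪ shift (W + k) B) (Finset.Icc (W + M + 1) (W + M + m')) := by
  rw [Finset.disjoint_left]
  intro v hv hv'
  have h1 := (Finset.mem_Icc.1 hv').1
  rcases Finset.mem_union.1 hv with hv | hv
  · have := (Finset.mem_Icc.1 hv).2
    omega
  · obtain ⟨a, ha, rfl⟩ := mem_shift.1 hv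
    have := (Finset.mem_Icc.1 (hB ha)).2
    omega

theorem card_padded (hB : B ⊆ Finset.Icc 1 N) (hm : m ≤ W) (hk : k + N ≤ M) :
    (padded W k M m m' B).card = m + B.card + m' := by
  rw [padded, Finset.card_union_of_disjoint (disjoint_padded_right hB hm hk),
    Finset.card_union_of_disjoint (disjoint_padded_left hB hm), card_shift, Nat.card_Icc,
    Nat.card_Icc]
  omega

theorem rank_padded (hB : B ⊆ Finset.Icc 1 N) (hm : m ≤ W) (hk : k + N ≤ M) {u : ℕ} (hu : u ≤ N) :
    rank (padded W k M m m' B) (W + k + u) = m + rank B u := by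
  rw [padded, rank_union (disjoint_padded_right hB hm hk), rank_union (disjoint_padded_left hB hm),
    rank_shift_add, rank_eq_card (A := Finset.Icc 1 m),
    rank_eq_zero (A := Finset.Icc (W + M + 1) _), Nat.card_Icc]
  · omega
  · intro a ha; have := (Finset.mem_Icc.1 ha).1; omega
  · intro a ha; have := (Finset.mem_Icc.1 ha).2; omega

theorem padded_subset (hB : B ⊆ Finset.Icc 1 N) (hm : m ≤ W) (hm' : m' ≤ W) (hk : k + N ≤ M) :
    padded W k M m m' B ⊆ Finset.Icc 1 (W + M + W) := by
  intro v hv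
  rw [padded, Finset.mem_union, Finset.mem_union] at hv
  rw [Finset.mem_Icc]
  rcases hv with (hv | hv) | hv
  · have := Finset.mem_Icc.1 hv; omega
  · obtain ⟨a, ha, rfl⟩ := mem_shift.1 hv
    have := Finset.mem_Icc.1 (hB ha); omega
  · have := Finset.mem_Icc.1 hv; omega

end padded

/-! ### Encoding split functions in Median -/

/-- `f` reduces to the Median problem of size `N`: the parties translate their inputs into subsets
of `{1, …, N}` with `p` and `q` elements whose median is the value of `f`, injectively coded. -/
def EmbedsInMedian (f : X → Y → Z) (p q N : ℕ) : Prop :=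
  ∃ (A : X → Finset ℕ) (B : Y → Finset ℕ) (v : Z → ℕ), Function.Injective v ∧
    (∀ z, v z ∈ Finset.Icc 1 N) ∧ (∀ x, A x ⊆ Finset.Icc 1 N ∧ (A x).card = p) ∧
    (∀ y, B y ⊆ Finset.Icc 1 N ∧ (B y).card = q) ∧ ∀ x y, IsMiddle (A x) (B y) (v (f x y))

theorem EmbedsInMedian.flip {f : X → Y → Z} {p q N : ℕ} (h : EmbedsInMedian f p q N) :
    EmbedsInMedian (flip f) q p N := by
  obtain ⟨A, B, v, hv, hN, hA, hB, hmid⟩ := h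
  exact ⟨B, A, v, hv, hN, hB, hA, fun y x => (hmid x y).symm⟩

/-- Alice writes her `r` sets into consecutive blocks. Bob writes his set into the block `i` and
pads it with `(r - 1 - i) * p` small and `i * p` large numbers. These balance Alice's other blocks,
so the median of the whole is the median inside block `i`. -/
theorem EmbedsInMedian.splitAlice {f : X → Y → Z} {p q N : ℕ} (h : EmbedsInMedian f p q N) (r : ℕ) :
    EmbedsInMedian (splitAlice r f) (r * p) (q + (r - 1) * p)
      ((r - 1) * p + r * N + (r - 1) * p) := by
  obtain ⟨A, B, v, hv, hN, hA, hB, hmid⟩ := h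
  set W := (r - 1) * p with hW
  have hpad : ∀ i : Fin r, (r - 1 - i) * p + i * p = W := fun i => by
    rw [← add_mul, hW]; congr 1; omega
  have hblock : ∀ i : Fin r, (i : ℕ) * N + N ≤ r * N := fun i => mul_add_le_mul_of_lt i.2 le_rfl
  refine ⟨fun x => blocks W N fun l => A (x l),
    fun y => padded W (y.1 * N) (r * N) ((r - 1 - y.1) * p) (y.1 * p) (B y.2),
    fun z => W + z.1 * N + v z.2, ?_, fun z => ?_, fun x => ⟨?_, ?_⟩, fun y => ⟨?_, ?_⟩,
    fun x y => ?_⟩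
  · rintro ⟨i, z⟩ ⟨j, z'⟩ h
    obtain ⟨h1, h2⟩ := block_unique (i := i) (j := j) (hN z) (hN z') (by simp only at h; omega)
    exact Prod.ext (Fin.ext h1) (hv h2)
  · have h1 := Finset.mem_Icc.1 (hN z.2)
    have h2 := hblock z.1
    simp only [Finset.mem_Icc]
    omega
  · refine (blocks_subset fun l => (hA (x l)).1).trans (Finset.Icc_subset_Icc ?_ ?_) <;> omega
  · exact card_blocks (fun l => (hA (x l)).1) fun l => (hA (x l)).2
  · have := hpad y.1
    exact padded_subset (hB y.2).1 (by omega) (by omega) (hblock y.1)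
  · have := hpad y.1
    rw [card_padded (hB y.2).1 (by omega) (hblock y.1), (hB y.2).2]
    omega
  · have h0 := hpad y.1
    have h1 := Finset.mem_Icc.1 (hN (f (x y.1) y.2))
    obtain ⟨h2, h3⟩ := hmid (x y.1) y.2
    have h4 : W + y.1 * N + v (f (x y.1) y.2) - 1 = W + y.1 * N + (v (f (x y.1) y.2) - 1) := by
      omega
    have h5 : r * p = p + W := by
      have hr : r = (r - 1) + 1 := by have := y.1.2; omega
      rw [hW]; nth_rw 1 [hr]; ring
    have hAl := fun l => (hA (x l)).1
    have hpl := fun l => (hA (x l)).2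
    unfold IsMiddle
    simp only [_root_.splitAlice]
    rw [h4, rank_blocks hAl hpl y.1 (by omega), rank_blocks hAl hpl y.1 h1.2,
      rank_padded (hB y.2).1 (by omega) (hblock y.1) (by omega),
      rank_padded (hB y.2).1 (by omega) (hblock y.1) h1.2, card_blocks hAl hpl,
      card_padded (hB y.2).1 (by omega) (hblock y.1)]
    rw [(hA _).2, (hB _).2] at h2 h3
    rw [(hB _).2]
    constructor <;> omega

theorem EmbedsInMedian.card_le [Nonempty X] {f : X → Y → Z} {p q N : ℕ}
    (h : EmbedsInMedian f p q N) : p ≤ N := by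
  obtain ⟨A, B, v, -, -, hA, -, -⟩ := h
  obtain ⟨x⟩ := ‹Nonempty X›
  have := Finset.card_le_card (hA x).1
  rw [(hA x).2, Nat.card_Icc] at this
  omega

theorem EmbedsInMedian.mono {f : X → Y → Z} {p q N N' : ℕ} (h : EmbedsInMedian f p q N)
    (hN : N ≤ N') : EmbedsInMedian f p q N' := by
  obtain ⟨A, B, v, hv, hNv, hA, hB, hmid⟩ := h
  have hsub := Finset.Icc_subset_Icc_right (a := 1) hN
  exact ⟨A, B, v, hv, fun z => hsub (hNv z), fun x => ⟨(hA x).1.trans hsub, (hA x).2⟩,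
    fun y => ⟨(hB y).1.trans hsub, (hB y).2⟩, hmid⟩

/-- The two splits enlarge the universe by a factor of at most `9 * r ^ 2`. -/
theorem EmbedsInMedian.split [Nonempty X] [Nonempty Y] {f : X → Y → Z} {p q N : ℕ}
    (h : EmbedsInMedian f p q N) {r : ℕ} (hr : 0 < r) :
    ∃ p' q', EmbedsInMedian (_root_.splitAlice r (splitBob r f)) p' q' (9 * r ^ 2 * N) := by
  have : NeZero r := ⟨hr.ne'⟩
  have h1 := h.flip.splitAlice r
  have hq : (r - 1) * q ≤ r * N := Nat.mul_le_mul (by omega) h.flip.card_le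
  have h2 : EmbedsInMedian (splitBob r f) _ _ (3 * r * N) :=
    h1.flip.mono (by rw [mul_assoc]; omega)
  have hp := h2.card_le
  refine ⟨_, _, (h2.splitAlice r).mono ?_⟩
  have h3 : (r - 1) * (p + (r - 1) * q) ≤ r * (3 * r * N) := Nat.mul_le_mul (by omega) hp
  calc _ ≤ r * (3 * r * N) + r * (3 * r * N) + r * (3 * r * N) := by omega
    _ = _ := by ring

end MedianEncoding

/-! ### The lower bound for Median -/

open SyncBitProtocol

/-- The `k`-fold iteration of the double split, started at a constant function, is hard and reduces
to the Median problem of size `(9 * r ^ 2) ^ k`. -/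
theorem exists_hard_embedsInMedian {T d r : ℕ} (hd : 0 < d) (hr : 24 * d ≤ r)
    (hdT : 24 * (T + 1) * (3 / 4 : ℝ) ^ d < 1) (k : ℕ) :
    ∃ (X Y Z : Type) (_ : Fintype X) (_ : Fintype Y) (_ : Nonempty X) (_ : Nonempty Y)
      (f : X → Y → Z) (p q : ℕ), EmbedsInMedian f p q ((9 * r ^ 2) ^ k) ∧ Hard f T k := by
  induction k with
  | zero =>
    refine ⟨Unit, Unit, Unit, inferInstance, inferInstance, inferInstance, inferInstance,
      fun _ _ => (), 1, 0, ⟨fun _ => {1}, fun _ => ∅, fun _ => 1, fun _ _ _ => rfl, by simp,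
        by simp, by simp, fun _ _ => ?_⟩, hard_zero _ _⟩
    constructor <;> simp [rank, Finset.filter_singleton]
  | succ k ih =>
    obtain ⟨X, Y, Z, _, _, _, _, f, p, q, hemb, hhard⟩ := ih
    obtain ⟨p', q', hemb'⟩ := hemb.split (r := r) (by omega)
    have : NeZero r := ⟨by omega⟩
    exact ⟨Fin r → Fin r × X, Fin r × (Fin r → Y), Fin r × Fin r × Z, inferInstance, inferInstance,
      inferInstance, inferInstance, splitAlice r (splitBob r f), p', q',
      by rwa [pow_succ, mul_comm], hhard.split hd hr hdT⟩

/-- A protocol for Median with at most `T` steps, where `T` enters through `d`, sends `k` bits as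
soon as `(9 * r ^ 2) ^ k ≤ n`. -/
theorem le_cost_of_computes_median {T d r k n : ℕ} (hd : 0 < d) (hr : 24 * d ≤ r)
    (hdT : 24 * (T + 1) * (3 / 4 : ℝ) ^ d < 1) (hn : (9 * r ^ 2) ^ k ≤ n)
    (P : SyncBitProtocol (Finset ℕ) (Finset ℕ) ℕ) (hT : P.time ≤ T)
    (hP : P.Computes (medianInputs n) median) : k ≤ P.cost (medianInputs n) := by
  obtain ⟨X, Y, Z, _, _, _, _, f, p, q, hemb, hhard⟩ := exists_hard_embedsInMedian hd hr hdT k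
  obtain ⟨A, B, v, hv, hvN, hA, hB, hmid⟩ := hemb.mono hn
  have hmem : ∀ x y, (A x, B y) ∈ medianInputs n := fun x y => by
    refine Finset.mem_filter.2 ⟨Finset.mem_product.2
      ⟨Finset.mem_powerset.2 (hA x).1, Finset.mem_powerset.2 (hB y).1⟩, ?_⟩
    have h := (hmid x y).1
    change (A x ∪ B y).Nonempty
    rw [Finset.union_nonempty, ← Finset.card_pos, ← Finset.card_pos]
    omega
  have hres : ∀ x y, P.result (A x) (B y) = v (f x y) := fun x y =>
    (hP _ (hmem x y)).trans (hmid x y).median_eq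
  obtain ⟨x, -, y, -, hxy⟩ := hhard (P.comap A B) Finset.univ Finset.univ 0 [] hT
    (by rw [Finset.card_univ]; linarith [(Nat.cast_nonneg (Fintype.card X) : (0 : ℝ) ≤ _)])
    (by rw [Finset.card_univ]; linarith [(Nat.cast_nonneg (Fintype.card Y) : (0 : ℝ) ≤ _)])
    (Nat.zero_le _) (fun _ _ _ _ => rfl)
    (fun x _ y _ x' _ y' _ h => by
      rw [result_comap, result_comap, hres, hres] at h
      exact hv h)
  rw [transcript_comap] at hxy
  exact (Nat.le_add_left _ _).trans (hxy.trans (Finset.le_sup (f := fun p : Finset ℕ × Finset ℕ =>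
    bitCount (P.transcript p.1 p.2 P.time)) (hmem x y)))

/-- `x ^ (1 - ε) * log x` is eventually below `x`, with room for constants. -/
theorem eventually_rpow_mul_log_le {ε : ℝ} (hε : 0 < ε) {C K : ℝ} (hC : 0 ≤ C) :
    ∀ᶠ x : ℝ in atTop, (C * x ^ (1 - ε) + 1) * (K + 2 * Real.log x) ≤ x := by
  set δ := min ε 1 with hδ
  have hδ0 : 0 < δ := lt_min hε one_pos
  have ho : (fun x : ℝ => (C + 1) * (K + 2 * Real.log x)) =o[atTop] fun x => x ^ δ := by
    refine IsLittleO.const_mul_left (IsLittleO.add ?_ ?_) _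
    · exact isLittleO_const_left.2 (Or.inr (tendsto_norm_atTop_atTop.comp (tendsto_rpow_atTop hδ0)))
    · exact (isLittleO_log_rpow_atTop hδ0).const_mul_left _
  filter_upwards [ho.bound one_pos, eventually_ge_atTop 1] with x hx hx1
  have hx0 : 0 < x := by linarith
  rw [one_mul, Real.norm_of_nonneg (Real.rpow_nonneg hx0.le _)] at hx
  have h1 : C * x ^ (1 - ε) + 1 ≤ (C + 1) * x ^ (1 - δ) := by
    have h2 : x ^ (1 - ε) ≤ x ^ (1 - δ) :=
      Real.rpow_le_rpow_of_exponent_le hx1 (by linarith [min_le_left ε 1])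
    have h3 : 1 ≤ x ^ (1 - δ) := Real.one_le_rpow hx1 (by linarith [min_le_right ε 1])
    nlinarith
  have h4 : 0 ≤ C * x ^ (1 - ε) + 1 := by positivity
  calc (C * x ^ (1 - ε) + 1) * (K + 2 * Real.log x)
      ≤ (C * x ^ (1 - ε) + 1) * |K + 2 * Real.log x| :=
        mul_le_mul_of_nonneg_left (le_abs_self _) h4
    _ ≤ (C + 1) * x ^ (1 - δ) * |K + 2 * Real.log x| :=
        mul_le_mul_of_nonneg_right h1 (abs_nonneg _)
    _ = x ^ (1 - δ) * ‖(C + 1) * (K + 2 * Real.log x)‖ := by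
        rw [Real.norm_eq_abs, abs_mul, abs_of_nonneg (by linarith : 0 ≤ C + 1)]; ring
    _ ≤ x ^ (1 - δ) * x ^ δ := mul_le_mul_of_nonneg_left hx (by positivity)
    _ = x := by rw [← Real.rpow_add hx0]; simp

theorem theorem1 (ε : ℝ) (hε : 0 < ε) :
    ¬ ∃ P : ℕ → SyncBitProtocol (Finset ℕ) (Finset ℕ) ℕ,
        (∀ n : ℕ, (P n).Computes (medianInputs n) median) ∧
        (∃ c : ℕ, (fun n : ℕ => ((P n).time : ℝ)) =O[atTop] fun n : ℕ => (n : ℝ) ^ c) ∧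
        (fun n : ℕ => ((P n).cost (medianInputs n) : ℝ)) =O[atTop]
          fun n : ℕ => Real.log (n : ℝ) ^ (1 - ε) := by
  rintro ⟨P, hP, ⟨c, htime⟩, hcost⟩
  obtain ⟨C₀, hC₀, htime⟩ := htime.exists_nonneg
  obtain ⟨C₁, hC₁, hcost⟩ := hcost.exists_nonneg
  -- `d` is chosen as `4 * (c + 3) * ⌈log n⌉`, so that `(3 / 4) ^ d ≤ n ^ (-(c + 3))`
  set K : ℝ := 9 * (192 * (c + 3)) ^ 2 with hK
  have hlog : Tendsto (fun n : ℕ => Real.log n) atTop atTop :=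
    Real.tendsto_log_atTop.comp tendsto_natCast_atTop_atTop
  have hcast : Tendsto (fun n : ℕ => (n : ℝ)) atTop atTop := tendsto_natCast_atTop_atTop
  obtain ⟨n, ht, hc, hn, hL, hbig⟩ := (htime.bound.and (hcost.bound.and
    ((hcast.eventually_ge_atTop (24 * C₀ + 25)).and ((hlog.eventually_ge_atTop 1).and
      (hlog.eventually (eventually_rpow_mul_log_le hε (K := Real.log K) hC₁)))))).exists
  set L := Real.log n with hLdef
  have hn0 : (0 : ℝ) < n := by linarith
  have hn1 : (1 : ℝ) ≤ n := by linarith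
  rw [Real.norm_of_nonneg (by positivity), Real.norm_of_nonneg (by positivity)] at ht
  rw [Real.norm_of_nonneg (by positivity),
    Real.norm_of_nonneg (Real.rpow_nonneg (by linarith) _)] at hc
  set d : ℕ := 4 * (c + 3) * ⌈L⌉₊ with hd
  have hceil : L ≤ ⌈L⌉₊ := Nat.le_ceil L
  have hceil' : (⌈L⌉₊ : ℝ) ≤ 2 * L := by
    have := Nat.ceil_lt_add_one (by linarith : 0 ≤ L)
    linarith
  have hceil0 : 0 < ⌈L⌉₊ := Nat.ceil_pos.2 (by linarith)
  have hpow : (3 / 4 : ℝ) ^ d * (n : ℝ) ^ (c + 3) ≤ 1 := by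
    have h1 : (3 / 4 : ℝ) ≤ Real.exp (-(1 / 4)) := by
      have := Real.add_one_le_exp (-(1 / 4 : ℝ))
      linarith
    have h2 : (n : ℝ) ^ (c + 3) = Real.exp ((c + 3 : ℕ) * L) := by
      rw [Real.exp_nat_mul, hLdef, Real.exp_log hn0]
    calc (3 / 4 : ℝ) ^ d * (n : ℝ) ^ (c + 3)
        ≤ Real.exp (-(1 / 4)) ^ d * (n : ℝ) ^ (c + 3) := by gcongr
      _ = Real.exp (d * (-(1 / 4)) + (c + 3 : ℕ) * L) := by
          rw [h2, ← Real.exp_nat_mul, Real.exp_add]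
      _ ≤ 1 := by
          rw [Real.exp_le_one_iff, hd]
          push_cast
          have : ((c : ℝ) + 3) * L ≤ (c + 3) * ⌈L⌉₊ := by gcongr
          linarith
  have hdT : 24 * (((P n).time : ℝ) + 1) * (3 / 4 : ℝ) ^ d < 1 := by
    have hp : 0 < (3 / 4 : ℝ) ^ d := by positivity
    have h1 : (1 : ℝ) ≤ (n : ℝ) ^ c := one_le_pow₀ hn1
    have h2 : 24 * (((P n).time : ℝ) + 1) < (n : ℝ) * n ^ c := by nlinarith
    have h3 : (n : ℝ) * n ^ c ≤ (n : ℝ) ^ (c + 3) := by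
      rw [← pow_succ']; exact pow_le_pow_right₀ hn1 (by omega)
    have h4 := mul_lt_mul_of_pos_right (h2.trans_le h3) hp
    linarith
  set k : ℕ := ⌊C₁ * L ^ (1 - ε)⌋₊ + 1 with hk
  have hkle : (k : ℝ) ≤ C₁ * L ^ (1 - ε) + 1 := by
    rw [hk]
    push_cast
    linarith [Nat.floor_le (mul_nonneg hC₁ (Real.rpow_nonneg (by linarith : 0 ≤ L) (1 - ε)))]
  have hK0 : 1 ≤ K := by
    have : (0 : ℝ) ≤ c := Nat.cast_nonneg c
    rw [hK]; nlinarith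
  have hr : ((9 * (24 * d) ^ 2 : ℕ) : ℝ) ≤ K * L ^ 2 := by
    rw [hK, mul_assoc 9 _ (L ^ 2), ← mul_pow, hd]
    push_cast
    have : (24 * (4 * ((c : ℝ) + 3) * ⌈L⌉₊)) ≤ 192 * (c + 3) * L := by
      have : ((c : ℝ) + 3) * ⌈L⌉₊ ≤ (c + 3) * (2 * L) := by gcongr
      linarith
    gcongr
  have hsize : (9 * (24 * d) ^ 2) ^ k ≤ n := by
    have hKL : 0 < K * L ^ 2 := by positivity
    have h1 : (((9 * (24 * d) ^ 2) ^ k : ℕ) : ℝ) ≤ (K * L ^ 2) ^ k := by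
      rw [Nat.cast_pow]; gcongr
    have h2 : (K * L ^ 2) ^ k ≤ n := by
      rw [← Real.log_le_log_iff (by positivity) hn0, Real.log_pow, Real.log_mul (by positivity)
        (by positivity), Real.log_pow]
      have h3 : 0 ≤ Real.log K + 2 * Real.log L :=
        add_nonneg (Real.log_nonneg hK0) (mul_nonneg zero_le_two (Real.log_nonneg hL))
      exact (mul_le_mul_of_nonneg_right hkle h3).trans hbig
    exact_mod_cast h1.trans h2
  have hfin := le_cost_of_computes_median (by positivity) le_rfl hdT hsize (P n) le_rfl (hP n)
  have h1 : (k : ℝ) ≤ C₁ * L ^ (1 - ε) := le_trans (by exact_mod_cast hfin) hc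
  have h2 := Nat.lt_floor_add_one (C₁ * L ^ (1 - ε))
  rw [hk] at h1
  push_cast at h1
  linarith
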